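/- Let $Q\in\mathbb{R}^{n\times n}$ be symmetric positive semidefinite and $R\in\mathbb{R}^{m\times m}$ symmetric positive definite. Suppose that on one time interval $\{0,\dots,T\}$ we are given inputs $u(0),\dots,u(T-1)\in\mathbb{R}^m$ and states $x(0),\dots,x(T)\in\mathbb{R}^n$ generated by some system $x(t+1)=A_sx(t)+B_su(t)$, and put $U_-=[u(0)\ \cdots\ u(T-1)]$, $X_-=[x(0)\ \cdots\ x(T-1)]$, $X_+=[x(1)\ \cdots\ x(T)]$; more generally, the data may consist of such measurements on several time intervals, where $U_-,X_-,X_+$ are the concatenations of the matrices of the separate intervals. Let $\Sigma_{\mathcal D}$ be the set of all pairs $(A,B)\in\mathbb{R}^{n\times n}\times\mathbb{R}^{n\times m}$ with $X_+=AX_-+BU_-$; thus $(A_s,B_s)\in\Sigma_{\mathcal D}$. The LQR problem is solvable for $(A,B,Q,R)$ if for every $x_0$ there is an input sequence with finite cost $J(x_0,u)=\sum_{t\ge0}\big(x(t)^\top Qx(t)+u(t)^\top Ru(t)\big)$, where $x(t+1)=Ax(t)+Bu(t)$, $x(0)=x_0$, for which $x(t)\to0$ and whose cost is minimal among all inputs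 for which $x(t)\to0$. In that case the optimal feedback gain for $(A,B,Q,R)$ is $K=-(R+B^\top PB)^{-1}B^\top PA$, where $P$ is the largest real symmetric solution of the Riccati equation $$P=A^\top PA-A^\top PB(R+B^\top PB)^{-1}B^\top PA+Q.$$ Suppose that the data are informative for optimal linear quadratic regulation, that is, the LQR problem is solvable for all $(A,B)\in\Sigma_{\mathcal D}$ and there is one matrix $K$ that is the optimal feedback gain for all $(A,B)\in\Sigma_{\mathcal D}$; let $K$ be such a matrix. Then there exist $M\in\mathbb{R}^{n\times n}$ and $P^+\ge0$ such that for all $(A,B)\in\Sigma_{\mathcal D}$: $M=A+BK$, the matrix $P^+$ satisfies the Riccati equation of $(A,B)$, $P^+-M^\top P^+M=K^\top RK+Q$, and $K=-(R+B^\top P^+B)^{-1}B^\top P^+A$. For any such $M$ and $P^+$, and with $$\mathcal L(P):=X_-^\top PX_--X_+^\top PX_+-X_-^\top QX_--U_-^\top RU_-,$$ the following hold. 1. $P^+$ is the unique solution of the optimization problem: maximize $\operatorname{trace}(P)$ subject to $P\ge0$ and $\mathcal L(P)\le0$. 2. There is a right inverse $X_-^\sharp$ of $X_-$ (that is, $X_-X_-^\sharp=I$)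 with $\mathcal L(P^+)X_-^\sharp=0$. Moreover, every right inverse $X_-^\sharp$ of $X_-$ with $\mathcal L(P^+)X_-^\sharp=0$ satisfies $K=U_-X_-^\sharp$. -/

import Mathlib

open scoped Matrix

/-- The state sequence of `x(t+1) = A x(t) + B u(t)` with `x(0) = x₀`. -/
def stateTrajectory {n m : ℕ} (A : Matrix (Fin n) (Fin n) ℝ) (B : Matrix (Fin n) (Fin m) ℝ)
    (x₀ : Fin n → ℝ) (u : ℕ → Fin m → ℝ) : ℕ → Fin n → ℝ
  | 0 => x₀
  | t + 1 => A *ᵥ stateTrajectory A B x₀ u t + B *ᵥ u t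

/-- The quadratic cost `∑ₜ x(t)ᵀ Q x(t) + u(t)ᵀ R u(t)`, with value in `[0, ∞]`; for `Q ≥ 0` and
`R > 0` all terms are nonnegative, so that `ENNReal.ofReal` does not change them. -/
noncomputable def lqrCost {n m : ℕ} (A : Matrix (Fin n) (Fin n) ℝ) (B : Matrix (Fin n) (Fin m) ℝ)
    (Q : Matrix (Fin n) (Fin n) ℝ) (R : Matrix (Fin m) (Fin m) ℝ)
    (x₀ : Fin n → ℝ) (u : ℕ → Fin m → ℝ) : ENNReal :=
  ∑' t : ℕ, ENNReal.ofReal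
    (stateTrajectory A B x₀ u t ⬝ᵥ (Q *ᵥ stateTrajectory A B x₀ u t) + u t ⬝ᵥ (R *ᵥ u t))

/-- The input `u` steers the state from `x₀` to zero asymptotically. -/
def SteersToZero {n m : ℕ} (A : Matrix (Fin n) (Fin n) ℝ) (B : Matrix (Fin n) (Fin m) ℝ)
    (x₀ : Fin n → ℝ) (u : ℕ → Fin m → ℝ) : Prop :=
  Filter.Tendsto (stateTrajectory A B x₀ u) Filter.atTop (nhds 0)

/-- The optimal LQR problem is solvable for `(A, B, Q, R)`: from every initial state there is an
input of finite cost that steers the state to zero and has least cost among all such inputs. -/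
def LQRSolvable {n m : ℕ} (A : Matrix (Fin n) (Fin n) ℝ) (B : Matrix (Fin n) (Fin m) ℝ)
    (Q : Matrix (Fin n) (Fin n) ℝ) (R : Matrix (Fin m) (Fin m) ℝ) : Prop :=
  ∀ x₀ : Fin n → ℝ, ∃ u : ℕ → Fin m → ℝ,
    lqrCost A B Q R x₀ u < ⊤ ∧ SteersToZero A B x₀ u ∧
      ∀ v : ℕ → Fin m → ℝ, SteersToZero A B x₀ v →
        lqrCost A B Q R x₀ u ≤ lqrCost A B Q R x₀ v

/-- `P` is a real symmetric solution of the discrete-time algebraic Riccati equation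
`P = AᵀPA - AᵀPB(R + BᵀPB)⁻¹BᵀPA + Q`; the inverse in the equation is required to exist. -/
def IsDARESolution {n m : ℕ} (A : Matrix (Fin n) (Fin n) ℝ) (B : Matrix (Fin n) (Fin m) ℝ)
    (Q : Matrix (Fin n) (Fin n) ℝ) (R : Matrix (Fin m) (Fin m) ℝ)
    (P : Matrix (Fin n) (Fin n) ℝ) : Prop :=
  P.IsSymm ∧ IsUnit (R + Bᵀ * P * B).det ∧
    P = Aᵀ * P * A - Aᵀ * P * B * (R + Bᵀ * P * B)⁻¹ * Bᵀ * P * A + Q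

/-- `P` is the largest real symmetric solution of the Riccati equation. -/
def IsLargestDARESolution {n m : ℕ} (A : Matrix (Fin n) (Fin n) ℝ)
    (B : Matrix (Fin n) (Fin m) ℝ) (Q : Matrix (Fin n) (Fin n) ℝ) (R : Matrix (Fin m) (Fin m) ℝ)
    (P : Matrix (Fin n) (Fin n) ℝ) : Prop :=
  IsDARESolution A B Q R P ∧ ∀ P', IsDARESolution A B Q R P' → (P - P').PosSemidef

/-- The gain `-(R + BᵀPB)⁻¹BᵀPA`. -/
noncomputable def riccatiGain {n m : ℕ} (A : Matrix (Fin n) (Fin n) ℝ)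
    (B : Matrix (Fin n) (Fin m) ℝ) (R : Matrix (Fin m) (Fin m) ℝ)
    (P : Matrix (Fin n) (Fin n) ℝ) : Matrix (Fin m) (Fin n) ℝ :=
  -((R + Bᵀ * P * B)⁻¹ * Bᵀ * P * A)

/-- `K` is the optimal feedback gain for `(A, B, Q, R)`: the optimal LQR problem is solvable, and
`K` is the gain that belongs to the largest real symmetric solution of the Riccati equation. -/
def IsOptimalGain {n m : ℕ} (A : Matrix (Fin n) (Fin n) ℝ) (B : Matrix (Fin n) (Fin m) ℝ)
    (Q : Matrix (Fin n) (Fin n) ℝ) (R : Matrix (Fin m) (Fin m) ℝ)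
    (K : Matrix (Fin m) (Fin n) ℝ) : Prop :=
  LQRSolvable A B Q R ∧ ∃ P, IsLargestDARESolution A B Q R P ∧ K = riccatiGain A B R P

/-- Input-state data with state dimension `n` and input dimension `m`, on `q` time intervals (one
interval is the case `q = 1`): on the `i`-th one, inputs `u(0), …, u(T i - 1)` and states
`x(0), …, x(T i)`. -/
structure InputStateData (n m : ℕ) where
  q : ℕ
  T : Fin q → ℕ
  u : (i : Fin q) → Fin (T i) → Fin m → ℝ
  x : (i : Fin q) → Fin (T i + 1) → Fin n → ℝ

namespace InputStateData

/-- The index set of the columns of the data matrices: all pairs of an interval and a time. -/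
abbrev Col {n m : ℕ} (D : InputStateData n m) : Type := (i : Fin D.q) × Fin (D.T i)

/-- The matrix `U₋`, with columns `u(0), …, u(T - 1)` (for every interval). -/
def Uminus {n m : ℕ} (D : InputStateData n m) : Matrix (Fin m) D.Col ℝ :=
  Matrix.of fun a c => D.u c.1 c.2 a

/-- The matrix `X₋`, with columns `x(0), …, x(T - 1)` (for every interval). -/
def Xminus {n m : ℕ} (D : InputStateData n m) : Matrix (Fin n) D.Col ℝ :=
  Matrix.of fun a c => D.x c.1 c.2.castSucc a

/-- The matrix `X₊`, with columns `x(1), …, x(T)` (for every interval). -/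
def Xplus {n m : ℕ} (D : InputStateData n m) : Matrix (Fin n) D.Col ℝ :=
  Matrix.of fun a c => D.x c.1 c.2.succ a

/-- `(A, B) ∈ Σ_D`: the system `(A, B)` is consistent with the data, `X₊ = A X₋ + B U₋`. -/
def Consistent {n m : ℕ} (D : InputStateData n m) (A : Matrix (Fin n) (Fin n) ℝ)
    (B : Matrix (Fin n) (Fin m) ℝ) : Prop :=
  D.Xplus = A * D.Xminus + B * D.Uminus

/-- `K` is the optimal feedback gain of every system that is consistent with the data. -/
def IsCommonOptimalGain {n m : ℕ} (D : InputStateData n m) (Q : Matrix (Fin n) (Fin n) ℝ)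
    (R : Matrix (Fin m) (Fin m) ℝ) (K : Matrix (Fin m) (Fin n) ℝ) : Prop :=
  ∀ A B, D.Consistent A B → IsOptimalGain A B Q R K

/-- The data are informative for optimal linear quadratic regulation. -/
def InformativeForLQR {n m : ℕ} (D : InputStateData n m) (Q : Matrix (Fin n) (Fin n) ℝ)
    (R : Matrix (Fin m) (Fin m) ℝ) : Prop :=
  (∀ A B, D.Consistent A B → LQRSolvable A B Q R) ∧ ∃ K, D.IsCommonOptimalGain Q R K

/-- `P ≥ 0` is a common solution of the Riccati equations of all systems `(A, B)` that are
consistent with the data, with gain `K` and common closed-loop matrix `M = A + BK`. -/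
def IsCommonRiccatiSolution {n m : ℕ} (D : InputStateData n m) (Q : Matrix (Fin n) (Fin n) ℝ)
    (R : Matrix (Fin m) (Fin m) ℝ) (K : Matrix (Fin m) (Fin n) ℝ)
    (M P : Matrix (Fin n) (Fin n) ℝ) : Prop :=
  P.PosSemidef ∧ ∀ A B, D.Consistent A B →
    M = A + B * K ∧ IsDARESolution A B Q R P ∧
      P - Mᵀ * P * M = Kᵀ * R * K + Q ∧ K = riccatiGain A B R P

/-- The map `ℒ(P) = X₋ᵀ P X₋ - X₊ᵀ P X₊ - X₋ᵀ Q X₋ - U₋ᵀ R U₋`. -/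
def calL {n m : ℕ} (D : InputStateData n m) (Q : Matrix (Fin n) (Fin n) ℝ)
    (R : Matrix (Fin m) (Fin m) ℝ) (P : Matrix (Fin n) (Fin n) ℝ) : Matrix D.Col D.Col ℝ :=
  D.Xminusᵀ * P * D.Xminus - D.Xplusᵀ * P * D.Xplus
    - D.Xminusᵀ * Q * D.Xminus - D.Uminusᵀ * R * D.Uminus

/-- The constraint set `P ≥ 0`, `ℒ(P) ≤ 0` of the semidefinite program. -/
def sdpFeasible {n m : ℕ} (D : InputStateData n m) (Q : Matrix (Fin n) (Fin n) ℝ)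
    (R : Matrix (Fin m) (Fin m) ℝ) : Set (Matrix (Fin n) (Fin n) ℝ) :=
  {P | P.PosSemidef ∧ (-D.calL Q R P).PosSemidef}

/-- The solutions of the semidefinite program: maximize `trace P` subject to `P ≥ 0` and
`ℒ(P) ≤ 0`. -/
def sdpSolutions {n m : ℕ} (D : InputStateData n m) (Q : Matrix (Fin n) (Fin n) ℝ)
    (R : Matrix (Fin m) (Fin m) ℝ) : Set (Matrix (Fin n) (Fin n) ℝ) :=
  {P | P ∈ D.sdpFeasible Q R ∧ ∀ P' ∈ D.sdpFeasible Q R, P'.trace ≤ P.trace}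

end InputStateData

/-! Everything rests on stability of the closed loops. If the LQR problem is solvable, its value
function is a quadratic form `P₀ ≥ 0` that solves the Riccati equation, so the largest solution `P`
satisfies `P ≥ P₀`. Completing the square with `P` along an optimal trajectory then forces the
optimal input to be the Riccati feedback, and this input steers the state to zero.

So `A + B * K` is stable for every consistent `(A, B)`. If `A₀ * X₋ + B₀ * U₋ = 0`, then `(A + F *
A₀, B + F * B₀)` is consistent for every `F`; stability bounds the trace of `A + B * K + F * (A₀ +
B₀ * K)`, which forces `A₀ + B₀ * K = 0`. Hence all consistent systems share one closed loop `M`,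
whose Lyapunov equation has only one solution, the common `P⁺`. By duality there is `S` with `X₋ * S
= 1` and `U₋ * S = K`.

Compressing `ℒ(P') ≤ 0` by `S` gives a Lyapunov inequality, hence `P' ≤ P⁺`; so `P⁺` alone maximizes
the trace. Finally `ℒ(P⁺) = -Eᵀ * G * E` with `E = U₋ - K * X₋` and `G > 0`, so for a right inverse
`X♯` of `X₋`, `ℒ(P⁺) * X♯ = 0` means `E * X♯ = 0`, which is `K = U₋ * X♯`. -/

namespace Matrix

/-! ### Semidefinite matrices and their quadratic forms. -/

theorem PosSemidef.isSymm {ι : Type*} {P : Matrix ι ι ℝ} (hP : P.PosSemidef) : P.IsSymm := by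
  rw [IsSymm, ← conjTranspose_eq_transpose_of_trivial]
  exact hP.isHermitian

theorem IsSymm.posSemidef_of_nonneg {ι : Type*} [Fintype ι] {P : Matrix ι ι ℝ} (hP : P.IsSymm)
    (h : ∀ x : ι → ℝ, 0 ≤ x ⬝ᵥ (P *ᵥ x)) : P.PosSemidef :=
  .of_dotProduct_mulVec_nonneg
    (by rwa [IsHermitian, conjTranspose_eq_transpose_of_trivial]) (by simpa using h)

theorem PosSemidef.quadratic_nonneg {ι : Type*} [Fintype ι] {P : Matrix ι ι ℝ}
    (hP : P.PosSemidef) (x : ι → ℝ) : 0 ≤ x ⬝ᵥ (P *ᵥ x) := by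
  simpa using hP.dotProduct_mulVec_nonneg x

/-- A positive definite form vanishes only at zero. -/
theorem PosDef.eq_zero_of_quadratic_nonpos {ι : Type*} [Fintype ι] {P : Matrix ι ι ℝ}
    (hP : P.PosDef) {x : ι → ℝ} (h : x ⬝ᵥ (P *ᵥ x) ≤ 0) : x = 0 := by
  by_contra hx
  have := hP.dotProduct_mulVec_pos hx
  simp only [star_trivial] at this
  linarith

theorem PosDef.eq_zero_of_transpose_mul_mul_eq_zero {ι κ : Type*} [Fintype ι] [Fintype κ]
    {G : Matrix ι ι ℝ} (hG : G.PosDef) {X : Matrix ι κ ℝ} (h : Xᵀ * G * X = 0) : X = 0 := by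
  ext i j
  have hj : (fun i => X i j) = 0 := by
    apply hG.eq_zero_of_quadratic_nonpos
    have := congrFun (congrFun h j) j
    rw [Matrix.mul_assoc, mul_apply] at this
    simpa [dotProduct, mulVec, mul_apply] using this.le
  exact congrFun hj i

/-- A symmetric matrix is determined by its quadratic form. -/
theorem IsSymm.eq_of_quadratic_eq {ι : Type*} [Fintype ι] [DecidableEq ι] {P P' : Matrix ι ι ℝ}
    (hP : P.IsSymm) (hP' : P'.IsSymm) (h : ∀ x : ι → ℝ, x ⬝ᵥ (P *ᵥ x) = x ⬝ᵥ (P' *ᵥ x)) :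
    P = P' := by
  ext i j
  have key : ∀ a b, Pi.single (M := fun _ : ι => ℝ) a 1 ⬝ᵥ (P *ᵥ Pi.single b 1) = P a b := by
    simp
  have hij := h (Pi.single i 1 + Pi.single j 1)
  have hi := h (Pi.single i 1)
  have hj := h (Pi.single j 1)
  simp only [mulVec_add, dotProduct_add, add_dotProduct, mulVec_single_one, single_one_dotProduct,
    col_apply] at hij hi hj
  have h1 := hP.apply i j
  have h2 := hP'.apply i j
  linarith

theorem quadratic_conj {ι κ : Type*} [Fintype ι] [Fintype κ] (M : Matrix ι κ ℝ) (P : Matrix ι ι ℝ)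
    (x : κ → ℝ) : x ⬝ᵥ ((Mᵀ * P * M) *ᵥ x) = (M *ᵥ x) ⬝ᵥ (P *ᵥ (M *ᵥ x)) := by
  rw [← mulVec_mulVec, ← mulVec_mulVec, dotProduct_mulVec, vecMul_transpose]

theorem PosSemidef.transpose_mul_mul_same {ι κ : Type*} [Fintype ι] [Fintype κ]
    {P : Matrix ι ι ℝ} (hP : P.PosSemidef) (M : Matrix ι κ ℝ) : (Mᵀ * P * M).PosSemidef := by
  simpa [conjTranspose_eq_transpose_of_trivial] using hP.conjTranspose_mul_mul_same M

/-! ### Schur stability and Lyapunov equations. -/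

/-- The powers of `M` tend to zero. -/
def IsSchurStable {ι : Type*} [Fintype ι] [DecidableEq ι] (M : Matrix ι ι ℝ) : Prop :=
  Filter.Tendsto (fun t : ℕ => M ^ t) Filter.atTop (nhds 0)

theorem isSchurStable_of_orbits {ι : Type*} [Fintype ι] [DecidableEq ι] {M : Matrix ι ι ℝ}
    (h : ∀ x : ι → ℝ, Filter.Tendsto (fun t : ℕ => M ^ t *ᵥ x) Filter.atTop (nhds 0)) :
    M.IsSchurStable := by
  refine tendsto_pi_nhds.2 fun i => tendsto_pi_nhds.2 fun j => ?_
  have := tendsto_pi_nhds.1 (h (Pi.single j 1)) i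
  simpa using this

/-- Over `ℂ` the trace is the sum of the eigenvalues, and an eigenvalue of modulus above one would
keep the powers from decaying on its eigenvector. -/
theorem IsSchurStable.abs_trace_le {ι : Type*} [Fintype ι] [DecidableEq ι] {M : Matrix ι ι ℝ}
    (hM : M.IsSchurStable) : |M.trace| ≤ Fintype.card ι := by
  set N : Matrix ι ι ℂ := M.map (algebraMap ℝ ℂ) with hN
  have hpow : Filter.Tendsto (fun t : ℕ => N ^ t) Filter.atTop (nhds 0) := by
    have h1 : ∀ t, N ^ t = (M ^ t).map (algebraMap ℝ ℂ) := fun t => by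
      rw [hN, ← RingHom.mapMatrix_apply, ← map_pow, RingHom.mapMatrix_apply]
    simp_rw [h1]
    have hc : Continuous fun A : Matrix ι ι ℝ => A.map (algebraMap ℝ ℂ) :=
      continuous_id.matrix_map (Complex.continuous_ofReal)
    have := (hc.tendsto 0).comp hM
    simpa [Function.comp_def] using this
  have hroot : ∀ z ∈ N.charpoly.roots, ‖z‖ ≤ 1 := by
    intro z hz
    have hz' : Module.End.HasEigenvalue (Matrix.toLin' N) z := by
      rw [Module.End.hasEigenvalue_iff_isRoot_charpoly]
      simpa using Polynomial.isRoot_of_mem_roots hz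
    obtain ⟨v, hv⟩ := hz'.exists_hasEigenvector
    have hv1 : ∀ t : ℕ, N ^ t *ᵥ v = z ^ t • v := fun t => by
      have := hv.pow_apply t
      rwa [← Matrix.toLin'_pow, Matrix.toLin'_apply] at this
    obtain ⟨i, hi⟩ := Function.ne_iff.1 hv.2
    have hlim : Filter.Tendsto (fun t : ℕ => z ^ t * v i) Filter.atTop (nhds 0) := by
      have hc : Continuous fun A : Matrix ι ι ℂ => (A *ᵥ v) i :=
        (continuous_apply i).comp (continuous_id.matrix_mulVec continuous_const)
      have := (hc.tendsto 0).comp hpow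
      simpa [Function.comp_def, hv1] using this
    by_contra hlt
    push Not at hlt
    have h2 : Filter.Tendsto (fun t : ℕ => ‖z ^ t * v i‖) Filter.atTop (nhds 0) := by
      simpa using hlim.norm
    have h3 : ‖v i‖ ≤ 0 := by
      refine ge_of_tendsto' h2 fun t => ?_
      rw [norm_mul, norm_pow]
      exact le_mul_of_one_le_left (norm_nonneg _) (one_le_pow₀ hlt.le)
    exact hi (norm_le_zero_iff.1 h3)
  have htr : (M.trace : ℂ) = N.charpoly.roots.sum := by
    rw [← Matrix.trace_eq_sum_roots_charpoly]
    simp [hN, Matrix.trace]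
  have hcard : N.charpoly.roots.card ≤ Fintype.card ι := by
    simpa using Polynomial.card_roots' N.charpoly
  have hsum : ∀ s : Multiset ℂ, (∀ z ∈ s, ‖z‖ ≤ 1) → ‖s.sum‖ ≤ s.card := by
    intro s
    induction s using Multiset.induction with
    | empty => simp
    | cons a s ih =>
      intro hs
      have h1 := ih fun z hz => hs z (Multiset.mem_cons_of_mem hz)
      have h2 := hs a (Multiset.mem_cons_self a s)
      have h3 := norm_add_le a s.sum
      simp only [Multiset.sum_cons, Multiset.card_cons, Nat.cast_add, Nat.cast_one]
      linarith
  calc |M.trace| = ‖(M.trace : ℂ)‖ := by simp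
    _ ≤ N.charpoly.roots.card := htr ▸ hsum _ hroot
    _ ≤ Fintype.card ι := by exact_mod_cast hcard

/-- A matrix along which stability is never lost, whatever it is multiplied by, is zero. -/
theorem eq_zero_of_forall_isSchurStable {ι : Type*} [Fintype ι] [DecidableEq ι]
    {M N : Matrix ι ι ℝ} (h : ∀ F : Matrix ι ι ℝ, (M + F * N).IsSchurStable) : N = 0 := by
  -- The choice `F = a • Nᵀ` makes the trace affine in `a` with slope `trace (Nᵀ * N)`; a bounded
  -- affine function has slope zero.
  have hb : ∀ a : ℝ, |M.trace + a * (Nᵀ * N).trace| ≤ Fintype.card ι := fun a => by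
    have := (h (a • Nᵀ)).abs_trace_le
    rwa [trace_add, smul_mul, trace_smul, smul_eq_mul] at this
  have h0 : (Nᵀ * N).trace = 0 := by
    by_contra hne
    have := hb ((Fintype.card ι + 1 - M.trace) / (Nᵀ * N).trace)
    rw [div_mul_cancel₀ _ hne, add_sub_cancel, abs_of_nonneg (by positivity)] at this
    linarith
  rw [← conjTranspose_eq_transpose_of_trivial] at h0
  exact trace_conjTranspose_mul_self_eq_zero_iff.1 h0

/-- The form of `D` does not increase along an orbit of `M`, and it tends to zero there. -/
theorem IsSchurStable.posSemidef_of_lyapunov {ι : Type*} [Fintype ι] [DecidableEq ι]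
    {M D : Matrix ι ι ℝ} (hM : M.IsSchurStable) (hD : D.IsSymm)
    (h : (D - Mᵀ * D * M).PosSemidef) : D.PosSemidef := by
  refine hD.posSemidef_of_nonneg fun x => ?_
  have step : ∀ y : ι → ℝ, (M *ᵥ y) ⬝ᵥ (D *ᵥ (M *ᵥ y)) ≤ y ⬝ᵥ (D *ᵥ y) := fun y => by
    have := h.quadratic_nonneg y
    rw [sub_mulVec, dotProduct_sub, quadratic_conj] at this
    linarith
  have hle : ∀ t : ℕ, (M ^ t *ᵥ x) ⬝ᵥ (D *ᵥ (M ^ t *ᵥ x)) ≤ x ⬝ᵥ (D *ᵥ x) := fun t => by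
    induction t with
    | zero => simp
    | succ t ih =>
      have := step (M ^ t *ᵥ x)
      rw [mulVec_mulVec, ← pow_succ'] at this
      exact this.trans ih
  have hc : Continuous fun A : Matrix ι ι ℝ => (A *ᵥ x) ⬝ᵥ (D *ᵥ (A *ᵥ x)) := by fun_prop
  have := (hc.tendsto 0).comp hM
  simp only [zero_mulVec, mulVec_zero, dotProduct_zero] at this
  exact le_of_tendsto' this hle

/-- The difference is unchanged under congruence by every power of `M`, and these powers tend to
zero. -/
theorem IsSchurStable.eq_of_lyapunov {ι : Type*} [Fintype ι] [DecidableEq ι]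
    {M P P' : Matrix ι ι ℝ} (hM : M.IsSchurStable)
    (h : P - Mᵀ * P * M = P' - Mᵀ * P' * M) : P = P' := by
  have h1 : P - P' = Mᵀ * (P - P') * M := by
    rw [Matrix.mul_sub, Matrix.sub_mul]
    rw [sub_eq_sub_iff_add_eq_add] at h ⊢
    rw [h, add_comm]
  have h2 : ∀ t : ℕ, P - P' = (M ^ t)ᵀ * (P - P') * M ^ t := fun t => by
    induction t with
    | zero => simp
    | succ t ih =>
      conv_lhs => rw [ih, h1]
      rw [pow_succ']
      simp only [transpose_mul, Matrix.mul_assoc]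
  have hc : Continuous fun A : Matrix ι ι ℝ => Aᵀ * (P - P') * A := by fun_prop
  have := (hc.tendsto 0).comp hM
  simp only [transpose_zero, Matrix.zero_mul, Function.comp_def, ← h2] at this
  exact sub_eq_zero.1 (tendsto_nhds_unique tendsto_const_nhds this)

/-! ### Duality between row relations and right factors. -/

/-- If every linear relation between the rows of `X` and `U` holds for `1` and `K`, then
`1 = X * S` and `K = U * S` for some `S`. -/
theorem exists_common_right_factor {ι κ γ : Type*} [Fintype ι] [DecidableEq ι] [Fintype κ]
    [DecidableEq κ] [Fintype γ] [DecidableEq γ]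
    {X : Matrix ι γ ℝ} {U : Matrix κ γ ℝ} {K : Matrix κ ι ℝ}
    (h : ∀ (A : Matrix ι ι ℝ) (B : Matrix ι κ ℝ), A * X + B * U = 0 → A + B * K = 0) :
    ∃ S : Matrix γ ι ℝ, X * S = 1 ∧ U * S = K := by
  set Z := fromRows X U
  have hcol : ∀ j : ι, ∃ s : γ → ℝ, Z *ᵥ s = Sum.elim (Pi.single j 1) (fun k => K k j) := by
    intro j
    by_contra hno
    have hmem : Sum.elim (Pi.single j 1) (fun k => K k j) ∉ LinearMap.range Z.mulVecLin := by
      rintro ⟨s, hs⟩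
      exact hno ⟨s, by simpa using hs⟩
    -- A functional that vanishes on the column space but not on the target column is a row relation
    -- of the data violated by `1` and `K`. Repeating it in every row gives the square matrix that
    -- `h` expects.
    obtain ⟨f, hf, hle⟩ := Submodule.exists_le_ker_of_notMem hmem
    set r : ι ⊕ κ → ℝ := fun i => f (Pi.single i 1) with hr
    have hfr : ∀ v, f v = r ⬝ᵥ v := fun v => by
      conv_lhs => rw [pi_eq_sum_univ' v]
      simp [dotProduct, hr, mul_comm]
    have hrZ : (fun i => r (Sum.inl i)) ᵥ* X + (fun i => r (Sum.inr i)) ᵥ* U = 0 := by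
      ext c
      have h0 : f (Z *ᵥ Pi.single c 1) = 0 := hle ⟨Pi.single c 1, rfl⟩
      rw [hfr] at h0
      simpa [Z, dotProduct, vecMul, Fintype.sum_sum_type] using h0
    have hAB := h (of fun _ i => r (Sum.inl i)) (of fun _ i => r (Sum.inr i)) (by
      ext i c
      simpa [vecMul, dotProduct, mul_apply] using congrFun hrZ c)
    apply hf
    rw [hfr]
    have := congrFun (congrFun hAB j) j
    simpa [dotProduct, Fintype.sum_sum_type, mul_apply, Pi.single_apply] using this
  choose S hS using hcol
  refine ⟨of fun c j => S j c, ?_, ?_⟩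
  · ext i j
    have := congrFun (hS j) (Sum.inl i)
    simpa [Z, mul_apply, mulVec, dotProduct, one_apply, Pi.single_apply] using this
  · ext k j
    have := congrFun (hS j) (Sum.inr k)
    simpa [Z, mul_apply, mulVec, dotProduct] using this

end Matrix

/-! ### Minimizing a nonnegative form over the fibres of a linear map. -/

namespace LinearMap.BilinForm

variable {E : Type*} [AddCommGroup E] [Module ℝ E]

theorem two_mul_abs_le_of_nonneg {σ : LinearMap.BilinForm ℝ E} (hs : ∀ x y, σ x y = σ y x)
    (hn : ∀ x, 0 ≤ σ x x) (x y : E) : 2 * |σ x y| ≤ σ x x + σ y y := by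
  have h1 := hn (x + y)
  have h2 := hn (x - y)
  simp only [map_add, map_sub, LinearMap.add_apply, LinearMap.sub_apply, hs y x] at h1 h2
  rcases abs_cases (σ x y) with h | h <;> linarith

/-- The sequences along which a nonnegative form is summable. -/
def squareSummable (σ : LinearMap.BilinForm ℝ E) (hs : ∀ x y, σ x y = σ y x)
    (hn : ∀ x, 0 ≤ σ x x) : Submodule ℝ (ℕ → E) where
  carrier := {f | Summable fun t => σ (f t) (f t)}
  zero_mem' := by simp
  add_mem' {f g} hf hg := by
    -- By the parallelogram law, the form at `f + g` is at most twice the sum of the forms at `f`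
    -- and `g`.
    refine Summable.of_nonneg_of_le (fun t => hn _) (fun t => ?_) ((hf.add hg).mul_left 2)
    have h2 := hn (f t - g t)
    simp only [Pi.add_apply, map_add, map_sub, LinearMap.add_apply, LinearMap.sub_apply,
      hs (g t) (f t)] at h2 ⊢
    linarith
  smul_mem' c f hf := by
    simpa [mul_assoc] using (hf.mul_left c).mul_left c

theorem summable_of_squareSummable {σ : LinearMap.BilinForm ℝ E} (hs : ∀ x y, σ x y = σ y x)
    (hn : ∀ x, 0 ≤ σ x x) {f g : ℕ → E} (hf : f ∈ squareSummable σ hs hn)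
    (hg : g ∈ squareSummable σ hs hn) : Summable fun t => σ (f t) (g t) := by
  refine Summable.of_norm_bounded (hf.add hg) fun t => ?_
  have := two_mul_abs_le_of_nonneg hs hn (f t) (g t)
  rw [Real.norm_eq_abs]
  linarith [abs_nonneg (σ (f t) (g t))]

/-- The sum of a nonnegative form along sequences. -/
noncomputable def tsumForm (σ : LinearMap.BilinForm ℝ E) (hs : ∀ x y, σ x y = σ y x)
    (hn : ∀ x, 0 ≤ σ x x) : LinearMap.BilinForm ℝ (squareSummable σ hs hn) :=
  LinearMap.mk₂ ℝ (fun f g => ∑' t, σ (f.1 t) (g.1 t))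
    (fun f f' g => by
      simpa using (summable_of_squareSummable hs hn f.2 g.2).tsum_add
        (summable_of_squareSummable hs hn f'.2 g.2))
    (fun c f g => by simpa using tsum_mul_left)
    (fun f g g' => by
      simpa using (summable_of_squareSummable hs hn f.2 g.2).tsum_add
        (summable_of_squareSummable hs hn f.2 g'.2))
    (fun c f g => by simpa using tsum_mul_left)

/-- The value of the problem of minimizing a nonnegative form over the fibres of a linear map is a
quadratic form, if all the minima are attained. -/
theorem exists_posSemidef_value {ι : Type*} [Fintype ι] [DecidableEq ι]
    {b : LinearMap.BilinForm ℝ E} (hs : ∀ x y, b x y = b y x) (hn : ∀ x, 0 ≤ b x x)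
    (e : E →ₗ[ℝ] ι → ℝ) (h : ∀ x, ∃ s, e s = x ∧ ∀ s', e s' = x → b s s ≤ b s' s') :
    ∃ P : Matrix ι ι ℝ, P.PosSemidef ∧ (∀ x, ∃ s, e s = x ∧ b s s = x ⬝ᵥ (P *ᵥ x)) ∧
      ∀ s, e s ⬝ᵥ (P *ᵥ e s) ≤ b s s := by
  choose m hm hmin using h
  have orth : ∀ x w, e w = 0 → b (m x) w = 0 := by
    intro x w hw
    have h1 : ∀ ε : ℝ, 0 ≤ 2 * ε * b (m x) w + ε ^ 2 * b w w := fun ε => by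
      have := hmin x (m x + ε • w) (by simp [hm, hw])
      simp only [map_add, map_smul, LinearMap.add_apply, LinearMap.smul_apply, smul_eq_mul,
        hs w (m x)] at this
      nlinarith
    have hc := hn w
    set c := b w w
    set d := b (m x) w
    -- A near-optimal step in the first variation; `c + 1` replaces `c` because the form may vanish
    -- at `w`.
    have h2 := h1 (-d / (c + 1))
    have h3 : 2 * (-d / (c + 1)) * d + (-d / (c + 1)) ^ 2 * c = -(d ^ 2 * (c + 2)) / (c + 1) ^ 2 := by
      field_simp
      ring
    rw [h3, le_div_iff₀ (by positivity)] at h2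
    have : d ^ 2 = 0 := by nlinarith [sq_nonneg d, mul_nonneg (sq_nonneg d) hc]
    exact pow_eq_zero_iff two_ne_zero |>.1 this
  -- Minimizers need not be unique, so `m` need not be linear. Extending linearly from the basis
  -- keeps orthogonality to the kernel of `e`, which is all that minimality needs.
  let L : (ι → ℝ) →ₗ[ℝ] E := (Pi.basisFun ℝ ι).constr ℝ fun i => m (Pi.single i 1)
  have hL : ∀ x, L x = ∑ i, x i • m (Pi.single i 1) := fun x => by
    simp [L, Module.Basis.constr_apply_fintype]
  have heL : ∀ x, e (L x) = x := fun x => by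
    simp only [hL, map_sum, map_smul, hm]
    exact (pi_eq_sum_univ' x).symm
  have hLorth : ∀ x w, e w = 0 → b (L x) w = 0 := fun x w hw => by
    simp [hL, orth _ w hw]
  let P : Matrix ι ι ℝ := Matrix.of fun i j => b (L (Pi.single i 1)) (L (Pi.single j 1))
  have hP : ∀ x, x ⬝ᵥ (P *ᵥ x) = b (L x) (L x) := fun x => by
    have hx : L x = ∑ i, x i • L (Pi.single i 1) := by
      conv_lhs => rw [pi_eq_sum_univ' x, map_sum]
      simp
    rw [hx]
    simp only [dotProduct, Matrix.mulVec, P, Matrix.of_apply, map_sum, map_smul,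
      LinearMap.sum_apply, LinearMap.smul_apply, smul_eq_mul, Finset.mul_sum]
    rw [Finset.sum_comm]
    exact Finset.sum_congr rfl fun i _ => Finset.sum_congr rfl fun j _ => by ring
  refine ⟨P, Matrix.IsSymm.posSemidef_of_nonneg (Matrix.ext fun i j => hs _ _)
    fun x => hP x ▸ hn _, fun x => ⟨L x, heL x, (hP x).symm⟩, fun s => ?_⟩
  have h0 := hLorth (e s) (s - L (e s)) (by simp [heL])
  have h1 := hn (s - L (e s))
  rw [hP]
  simp only [map_sub, LinearMap.sub_apply, hs s (L (e s))] at h0 h1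
  linarith

end LinearMap.BilinForm

/-! ### The value function of the LQR problem. -/

section LQR

variable {n m : ℕ}

/-- The stage cost `xᵀ Q y + uᵀ R v` as a bilinear form on pairs of a state and an input. -/
noncomputable def stageForm (Q : Matrix (Fin n) (Fin n) ℝ) (R : Matrix (Fin m) (Fin m) ℝ) :
    LinearMap.BilinForm ℝ ((Fin n → ℝ) × (Fin m → ℝ)) :=
  LinearMap.mk₂ ℝ (fun z w => z.1 ⬝ᵥ (Q *ᵥ w.1) + z.2 ⬝ᵥ (R *ᵥ w.2))
    (fun z z' w => by simp only [Prod.fst_add, Prod.snd_add, add_dotProduct]; ring)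
    (fun c z w => by simp only [Prod.smul_fst, Prod.smul_snd, smul_dotProduct, smul_add])
    (fun z w w' => by
      simp only [Prod.fst_add, Prod.snd_add, Matrix.mulVec_add, dotProduct_add]; ring)
    (fun c z w => by
      simp only [Prod.smul_fst, Prod.smul_snd, Matrix.mulVec_smul, dotProduct_smul, smul_add])

theorem stageForm_apply (Q : Matrix (Fin n) (Fin n) ℝ) (R : Matrix (Fin m) (Fin m) ℝ)
    (z w : (Fin n → ℝ) × (Fin m → ℝ)) :
    stageForm Q R z w = z.1 ⬝ᵥ (Q *ᵥ w.1) + z.2 ⬝ᵥ (R *ᵥ w.2) := rfl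

theorem stageForm_comm {Q : Matrix (Fin n) (Fin n) ℝ} {R : Matrix (Fin m) (Fin m) ℝ}
    (hQ : Q.IsSymm) (hR : R.IsSymm) (z w : (Fin n → ℝ) × (Fin m → ℝ)) :
    stageForm Q R z w = stageForm Q R w z := by
  have key : ∀ {k : ℕ} {S : Matrix (Fin k) (Fin k) ℝ}, S.IsSymm → ∀ a b : Fin k → ℝ,
      a ⬝ᵥ (S *ᵥ b) = b ⬝ᵥ (S *ᵥ a) := fun {k S} hS a b => by
    rw [Matrix.dotProduct_mulVec, ← Matrix.mulVec_transpose, hS.eq, dotProduct_comm]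
  rw [stageForm_apply, stageForm_apply, key hQ, key hR]

theorem stageForm_self_nonneg {Q : Matrix (Fin n) (Fin n) ℝ} {R : Matrix (Fin m) (Fin m) ℝ}
    (hQ : Q.PosSemidef) (hR : R.PosSemidef) (z : (Fin n → ℝ) × (Fin m → ℝ)) :
    0 ≤ stageForm Q R z z :=
  add_nonneg (hQ.quadratic_nonneg _) (hR.quadratic_nonneg _)

/-- State and input over time, as a linear function of initial state and input sequence. -/
def trajectory (A : Matrix (Fin n) (Fin n) ℝ) (B : Matrix (Fin n) (Fin m) ℝ) :
    ((Fin n → ℝ) × (ℕ → Fin m → ℝ)) →ₗ[ℝ] ℕ → (Fin n → ℝ) × (Fin m → ℝ) where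
  toFun z t := (stateTrajectory A B z.1 z.2 t, z.2 t)
  map_add' z w := by
    funext t
    refine Prod.ext ?_ rfl
    induction t with
    | zero => rfl
    | succ t ih =>
      simp only [stateTrajectory, Prod.fst_add, Prod.snd_add, Pi.add_apply] at ih ⊢
      rw [ih, Matrix.mulVec_add, Matrix.mulVec_add]
      abel
  map_smul' c z := by
    funext t
    refine Prod.ext ?_ rfl
    induction t with
    | zero => rfl
    | succ t ih =>
      simp only [stateTrajectory, Prod.smul_fst, Prod.smul_snd, Pi.smul_apply,
        RingHom.id_apply] at ih ⊢
      rw [ih, Matrix.mulVec_smul, Matrix.mulVec_smul, smul_add]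

/-- The pairs of an initial state and an input that steers it to zero. -/
def steeringPairs (A : Matrix (Fin n) (Fin n) ℝ) (B : Matrix (Fin n) (Fin m) ℝ) :
    Submodule ℝ ((Fin n → ℝ) × (ℕ → Fin m → ℝ)) where
  carrier := {z | SteersToZero A B z.1 z.2}
  zero_mem' := by
    have h : ∀ t, stateTrajectory A B 0 0 t = 0 := fun t =>
      congrArg Prod.fst (congrFun (map_zero (trajectory A B)) t)
    simp [SteersToZero, funext h]
  add_mem' {z w} hz hw := by
    have h : stateTrajectory A B (z + w).1 (z + w).2 =
        fun t => stateTrajectory A B z.1 z.2 t + stateTrajectory A B w.1 w.2 t := funext fun t =>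
      congrArg Prod.fst (congrFun (map_add (trajectory A B) z w) t)
    change Filter.Tendsto _ _ _
    rw [h]
    simpa using Filter.Tendsto.add hz hw
  smul_mem' c z hz := by
    have h : stateTrajectory A B (c • z).1 (c • z).2 =
        fun t => c • stateTrajectory A B z.1 z.2 t := funext fun t =>
      congrArg Prod.fst (congrFun (map_smul (trajectory A B) c z) t)
    change Filter.Tendsto _ _ _
    rw [h]
    simpa using Filter.Tendsto.const_smul hz c

/-- The cost of the system `(A, B)` at time `t`. -/
noncomputable def stageCost (A : Matrix (Fin n) (Fin n) ℝ) (B : Matrix (Fin n) (Fin m) ℝ)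
    (Q : Matrix (Fin n) (Fin n) ℝ) (R : Matrix (Fin m) (Fin m) ℝ)
    (x₀ : Fin n → ℝ) (u : ℕ → Fin m → ℝ) (t : ℕ) : ℝ :=
  stateTrajectory A B x₀ u t ⬝ᵥ (Q *ᵥ stateTrajectory A B x₀ u t) + u t ⬝ᵥ (R *ᵥ u t)

theorem stageCost_nonneg {Q : Matrix (Fin n) (Fin n) ℝ} {R : Matrix (Fin m) (Fin m) ℝ}
    (hQ : Q.PosSemidef) (hR : R.PosSemidef) (A : Matrix (Fin n) (Fin n) ℝ)
    (B : Matrix (Fin n) (Fin m) ℝ) (x₀ : Fin n → ℝ) (u : ℕ → Fin m → ℝ) (t : ℕ) :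
    0 ≤ stageCost A B Q R x₀ u t :=
  add_nonneg (hQ.quadratic_nonneg _) (hR.quadratic_nonneg _)

/-- The value function of a solvable LQR problem is a quadratic form. -/
theorem LQRSolvable.exists_value {A : Matrix (Fin n) (Fin n) ℝ} {B : Matrix (Fin n) (Fin m) ℝ}
    {Q : Matrix (Fin n) (Fin n) ℝ} {R : Matrix (Fin m) (Fin m) ℝ}
    (hQ : Q.PosSemidef) (hR : R.PosSemidef) (h : LQRSolvable A B Q R) :
    ∃ P : Matrix (Fin n) (Fin n) ℝ, P.PosSemidef ∧
      (∀ x, ∃ u, SteersToZero A B x u ∧ HasSum (stageCost A B Q R x u) (x ⬝ᵥ (P *ᵥ x))) ∧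
      ∀ x u c, SteersToZero A B x u → HasSum (stageCost A B Q R x u) c →
        x ⬝ᵥ (P *ᵥ x) ≤ c := by
  have hs := stageForm_comm hQ.isSymm hR.isSymm
  have hn := stageForm_self_nonneg hQ hR
  -- On the steering pairs of finite cost, the cost is a nonnegative quadratic form, and the LQR
  -- problem minimizes it over the fibres of the initial state.
  let S := steeringPairs A B ⊓
    (LinearMap.BilinForm.squareSummable (stageForm Q R) hs hn).comap (trajectory A B)
  let τ : S →ₗ[ℝ] LinearMap.BilinForm.squareSummable (stageForm Q R) hs hn :=
    ((trajectory A B).comp S.subtype).codRestrict _ fun s => s.2.2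
  let b : LinearMap.BilinForm ℝ S := (LinearMap.BilinForm.tsumForm _ hs hn).compl₁₂ τ τ
  have hb : ∀ s : S, b s s = ∑' t, stageCost A B Q R s.1.1 s.1.2 t := fun s => rfl
  have hcost : ∀ s : S, lqrCost A B Q R s.1.1 s.1.2 = ENNReal.ofReal (b s s) := fun s => by
    rw [hb, ENNReal.ofReal_tsum_of_nonneg (stageCost_nonneg hQ hR A B _ _) s.2.2]
    rfl
  have hbn : ∀ s, 0 ≤ b s s := fun s => tsum_nonneg fun t => hn _
  have hbs : ∀ s s', b s s' = b s' s := fun s s' => tsum_congr fun t => hs _ _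
  obtain ⟨P, hP, hatt, hle⟩ := LinearMap.BilinForm.exists_posSemidef_value hbs hbn
    ((LinearMap.fst ℝ _ _).comp S.subtype) fun x => by
      obtain ⟨u, hfin, hst, hopt⟩ := h x
      have hsum : Summable (stageCost A B Q R x u) := by
        refine (ENNReal.summable_toReal hfin.ne).congr fun t => ?_
        exact ENNReal.toReal_ofReal (stageCost_nonneg hQ hR A B x u t)
      refine ⟨⟨(x, u), hst, hsum⟩, rfl, ?_⟩
      rintro s' rfl
      have := hopt s'.1.2 s'.2.1
      have h1 := hcost ⟨(_, u), hst, hsum⟩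
      have h2 := hcost s'
      simp only at h1
      erw [h1, h2] at this
      exact (ENNReal.ofReal_le_ofReal_iff (hbn s')).1 this
  refine ⟨P, hP, fun x => ?_, fun x u c hst hc => ?_⟩
  · obtain ⟨s, rfl, hsx⟩ := hatt x
    exact ⟨s.1.2, s.2.1, hsx ▸ s.2.2.hasSum⟩
  · have := hle ⟨(x, u), hst, hc.summable⟩
    rw [hb] at this
    exact this.trans_eq hc.tsum_eq

end LQR

/-! ### The Riccati equation and stability of the optimal closed loop. -/

section Riccati

variable {n m : ℕ}

theorem isSymm_inputWeight {B : Matrix (Fin n) (Fin m) ℝ} {R : Matrix (Fin m) (Fin m) ℝ}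
    {P : Matrix (Fin n) (Fin n) ℝ} (hR : R.IsSymm) (hP : P.IsSymm) :
    (R + Bᵀ * P * B).IsSymm := by
  simp only [Matrix.IsSymm, Matrix.transpose_add, Matrix.transpose_mul, Matrix.transpose_transpose,
    hR.eq, hP.eq, Matrix.mul_assoc]

theorem posDef_inputWeight {R : Matrix (Fin m) (Fin m) ℝ} {P : Matrix (Fin n) (Fin n) ℝ}
    (hR : R.PosDef) (hP : P.PosSemidef) (B : Matrix (Fin n) (Fin m) ℝ) :
    (R + Bᵀ * P * B).PosDef :=
  hR.add_posSemidef (hP.transpose_mul_mul_same B)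

/-- Completing the square with respect to the input. -/
theorem stage_add_next_eq {γ : Type*} {A : Matrix (Fin n) (Fin n) ℝ}
    {B : Matrix (Fin n) (Fin m) ℝ} {R : Matrix (Fin m) (Fin m) ℝ} {P : Matrix (Fin n) (Fin n) ℝ}
    (hR : R.IsSymm) (hP : P.IsSymm) (hdet : IsUnit (R + Bᵀ * P * B).det)
    (Q : Matrix (Fin n) (Fin n) ℝ) (X : Matrix (Fin n) γ ℝ) (U : Matrix (Fin m) γ ℝ) :
    Xᵀ * Q * X + Uᵀ * R * U + (A * X + B * U)ᵀ * P * (A * X + B * U) =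
      Xᵀ * (Aᵀ * P * A - Aᵀ * P * B * (R + Bᵀ * P * B)⁻¹ * Bᵀ * P * A + Q) * X +
        (U - riccatiGain A B R P * X)ᵀ * (R + Bᵀ * P * B) * (U - riccatiGain A B R P * X) := by
  have hGs := isSymm_inputWeight (B := B) hR hP
  set G := R + Bᵀ * P * B with hG
  set K := riccatiGain A B R P with hK
  have hGK : G * K = -(Bᵀ * P * A) := by
    rw [hK, riccatiGain, ← hG, Matrix.mul_neg, Matrix.mul_assoc, Matrix.mul_assoc,
      Matrix.mul_nonsing_inv_cancel_left _ _ hdet, Matrix.mul_assoc]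
  have hKG : Kᵀ * G = -(Aᵀ * P * B) := by
    have := congrArg Matrix.transpose hGK
    simpa [Matrix.transpose_mul, hGs.eq, hP.eq, Matrix.mul_assoc] using this
  have hKGK : Aᵀ * P * B * G⁻¹ * Bᵀ * P * A = Kᵀ * G * K := by
    rw [hKG, hK, riccatiGain, ← hG]
    simp only [Matrix.neg_mul, Matrix.mul_neg, neg_neg, Matrix.mul_assoc]
  have hR' : R = G - Bᵀ * P * B := by rw [hG, add_sub_cancel_right]
  have e1 : Uᵀ * G * (K * X) = -(Uᵀ * (Bᵀ * P * A) * X) := by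
    rw [Matrix.mul_assoc, ← Matrix.mul_assoc G, hGK]
    simp only [Matrix.neg_mul, Matrix.mul_neg, Matrix.mul_assoc]
  have e2 : (K * X)ᵀ * G * U = -(Xᵀ * (Aᵀ * P * B) * U) := by
    rw [Matrix.transpose_mul, Matrix.mul_assoc Xᵀ, hKG]
    simp only [Matrix.neg_mul, Matrix.mul_neg, Matrix.mul_assoc]
  have e3 : (K * X)ᵀ * G * (K * X) = Xᵀ * (Kᵀ * G * K) * X := by
    simp only [Matrix.transpose_mul, Matrix.mul_assoc]
  rw [hKGK, Matrix.transpose_sub, Matrix.sub_mul, Matrix.sub_mul, Matrix.mul_sub, Matrix.mul_sub,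
    e1, e2, e3]
  nth_rw 1 [hR']
  simp only [Matrix.transpose_add, Matrix.transpose_mul, Matrix.mul_add, Matrix.add_mul,
    Matrix.mul_sub, Matrix.sub_mul, Matrix.mul_assoc]
  abel

/-- Completing the square for a solution of the Riccati equation. -/
theorem IsDARESolution.stage_add_next_eq {γ : Type*} {A : Matrix (Fin n) (Fin n) ℝ}
    {B : Matrix (Fin n) (Fin m) ℝ} {Q : Matrix (Fin n) (Fin n) ℝ} {R : Matrix (Fin m) (Fin m) ℝ}
    {P : Matrix (Fin n) (Fin n) ℝ} (h : IsDARESolution A B Q R P) (hR : R.IsSymm)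
    (X : Matrix (Fin n) γ ℝ) (U : Matrix (Fin m) γ ℝ) :
    Xᵀ * Q * X + Uᵀ * R * U + (A * X + B * U)ᵀ * P * (A * X + B * U) =
      Xᵀ * P * X +
        (U - riccatiGain A B R P * X)ᵀ * (R + Bᵀ * P * B) * (U - riccatiGain A B R P * X) := by
  rw [_root_.stage_add_next_eq hR h.1 h.2.1 Q X U, ← h.2.2]

/-- A solution of the Riccati equation solves the Lyapunov equation of its closed loop. -/
theorem IsDARESolution.lyapunov {A : Matrix (Fin n) (Fin n) ℝ}
    {B : Matrix (Fin n) (Fin m) ℝ} {Q : Matrix (Fin n) (Fin n) ℝ} {R : Matrix (Fin m) (Fin m) ℝ}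
    {P : Matrix (Fin n) (Fin n) ℝ} {K : Matrix (Fin m) (Fin n) ℝ}
    (h : IsDARESolution A B Q R P) (hR : R.IsSymm) (hK : K = riccatiGain A B R P) :
    P - (A + B * K)ᵀ * P * (A + B * K) = Kᵀ * R * K + Q := by
  -- With `X = 1` and `U = K` the square vanishes.
  have := h.stage_add_next_eq hR 1 K
  simp only [← hK, Matrix.mul_one, Matrix.one_mul, Matrix.transpose_one, sub_self, Matrix.mul_zero,
    add_zero] at this
  rw [sub_eq_iff_eq_add, add_comm _ Q, this]

/-- The one-column case. The Riccati equation is not assumed, so the identity applies to the value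
function before that equation is known for it. -/
theorem stage_add_next_vec_eq {A : Matrix (Fin n) (Fin n) ℝ}
    {B : Matrix (Fin n) (Fin m) ℝ} {R : Matrix (Fin m) (Fin m) ℝ} {P : Matrix (Fin n) (Fin n) ℝ}
    (hR : R.IsSymm) (hP : P.IsSymm) (hdet : IsUnit (R + Bᵀ * P * B).det)
    (Q : Matrix (Fin n) (Fin n) ℝ) (x : Fin n → ℝ) (u : Fin m → ℝ) :
    x ⬝ᵥ (Q *ᵥ x) + u ⬝ᵥ (R *ᵥ u) + (A *ᵥ x + B *ᵥ u) ⬝ᵥ (P *ᵥ (A *ᵥ x + B *ᵥ u)) =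
      x ⬝ᵥ ((Aᵀ * P * A - Aᵀ * P * B * (R + Bᵀ * P * B)⁻¹ * Bᵀ * P * A + Q) *ᵥ x) +
        (u - riccatiGain A B R P *ᵥ x) ⬝ᵥ
          ((R + Bᵀ * P * B) *ᵥ (u - riccatiGain A B R P *ᵥ x)) := by
  have key : ∀ {k : ℕ} (S : Matrix (Fin k) (Fin k) ℝ) (z : Fin k → ℝ),
      ((Matrix.replicateCol Unit z)ᵀ * S * Matrix.replicateCol Unit z) () () = z ⬝ᵥ (S *ᵥ z) :=
    fun S z => by
      rw [Matrix.mul_assoc, ← Matrix.replicateCol_mulVec]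
      rfl
  have h1 : A * Matrix.replicateCol Unit x + B * Matrix.replicateCol Unit u =
      Matrix.replicateCol Unit (A *ᵥ x + B *ᵥ u) := by
    rw [Matrix.replicateCol_add, Matrix.replicateCol_mulVec, Matrix.replicateCol_mulVec]
  have h2 : Matrix.replicateCol Unit u - riccatiGain A B R P * Matrix.replicateCol Unit x =
      Matrix.replicateCol Unit (u - riccatiGain A B R P *ᵥ x) := by
    rw [← Matrix.replicateCol_mulVec]
    rfl
  have := congrFun (congrFun (stage_add_next_eq (A := A) hR hP hdet Q
    (Matrix.replicateCol Unit x) (Matrix.replicateCol Unit u)) ()) ()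
  rw [h1, h2] at this
  simpa only [Matrix.add_apply _ _ () (), key] using this

theorem stateTrajectory_shift (A : Matrix (Fin n) (Fin n) ℝ) (B : Matrix (Fin n) (Fin m) ℝ)
    (x : Fin n → ℝ) (u : ℕ → Fin m → ℝ) (t : ℕ) :
    stateTrajectory A B (A *ᵥ x + B *ᵥ u 0) (fun s => u (s + 1)) t =
      stateTrajectory A B x u (t + 1) := by
  induction t with
  | zero => rfl
  | succ t ih => rw [stateTrajectory, ih]; rfl

/-- If the value function of the LQR problem is a quadratic form, then its matrix solves the
Riccati equation. -/
theorem isDARESolution_of_value {A : Matrix (Fin n) (Fin n) ℝ} {B : Matrix (Fin n) (Fin m) ℝ}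
    {Q : Matrix (Fin n) (Fin n) ℝ} {R : Matrix (Fin m) (Fin m) ℝ} {P : Matrix (Fin n) (Fin n) ℝ}
    (hQ : Q.PosSemidef) (hR : R.PosDef) (hP : P.PosSemidef)
    (hatt : ∀ x, ∃ u, SteersToZero A B x u ∧ HasSum (stageCost A B Q R x u) (x ⬝ᵥ (P *ᵥ x)))
    (hle : ∀ x u c, SteersToZero A B x u → HasSum (stageCost A B Q R x u) c →
      x ⬝ᵥ (P *ᵥ x) ≤ c) : IsDARESolution A B Q R P := by
  have hG := posDef_inputWeight hR hP B
  have hdet : IsUnit (R + Bᵀ * P * B).det := hG.det_pos.ne'.isUnit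
  have hshift : ∀ x u t, stageCost A B Q R (A *ᵥ x + B *ᵥ u 0) (fun s => u (s + 1)) t =
      stageCost A B Q R x u (t + 1) := fun x u t => by
    rw [stageCost, stateTrajectory_shift, stageCost]
  have hsteer : ∀ x u, SteersToZero A B (A *ᵥ x + B *ᵥ u 0) (fun s => u (s + 1)) ↔
      SteersToZero A B x u := fun x u => by
    rw [SteersToZero, SteersToZero, funext (stateTrajectory_shift A B x u)]
    exact Filter.tendsto_add_atTop_iff_nat 1
  have dp_le : ∀ x v, x ⬝ᵥ (P *ᵥ x) ≤ x ⬝ᵥ (Q *ᵥ x) + v ⬝ᵥ (R *ᵥ v) +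
      (A *ᵥ x + B *ᵥ v) ⬝ᵥ (P *ᵥ (A *ᵥ x + B *ᵥ v)) := by
    intro x v
    obtain ⟨w, hw, hsum⟩ := hatt (A *ᵥ x + B *ᵥ v)
    let u : ℕ → Fin m → ℝ := fun t => Nat.casesOn t v w
    refine hle x u _ ((hsteer x u).1 hw) ?_
    refine (hasSum_nat_add_iff' 1).1 ?_
    rw [Finset.sum_range_one]
    convert! hsum using 1
    · exact (funext (hshift x u)).symm
    · exact add_sub_cancel_left _ _
  have dp_ge : ∀ x, ∃ v, x ⬝ᵥ (Q *ᵥ x) + v ⬝ᵥ (R *ᵥ v) +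
      (A *ᵥ x + B *ᵥ v) ⬝ᵥ (P *ᵥ (A *ᵥ x + B *ᵥ v)) ≤ x ⬝ᵥ (P *ᵥ x) := by
    intro x
    obtain ⟨u, hu, hsum⟩ := hatt x
    have h1 := (hasSum_nat_add_iff' 1).2 hsum
    have h2 := hle _ _ _ ((hsteer x u).2 hu) ((funext (hshift x u)) ▸ h1)
    refine ⟨u 0, ?_⟩
    simp only [Finset.range_one, Finset.sum_singleton, stageCost, stateTrajectory] at h2
    linarith
  refine ⟨hP.isSymm, hdet, Matrix.IsSymm.eq_of_quadratic_eq hP.isSymm ?_ fun x => le_antisymm ?_ ?_⟩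
  · have hGi : ((R + Bᵀ * P * B)⁻¹)ᵀ = (R + Bᵀ * P * B)⁻¹ := by
      rw [Matrix.transpose_nonsing_inv, hG.posSemidef.isSymm.eq]
    rw [Matrix.mul_assoc Bᵀ] at hGi
    simp only [Matrix.IsSymm, Matrix.transpose_add, Matrix.transpose_sub, Matrix.transpose_mul,
      Matrix.transpose_transpose, hGi, hP.isSymm.eq, hQ.isSymm.eq, Matrix.mul_assoc]
  -- Bellman's inequality at the Riccati feedback, where the square vanishes; in the other
  -- direction, the first optimal input leaves a nonnegative square to discard.
  · have h1 := dp_le x (riccatiGain A B R P *ᵥ x)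
    rw [stage_add_next_vec_eq hR.posSemidef.isSymm hP.isSymm hdet, sub_self, zero_dotProduct,
      add_zero] at h1
    exact h1
  · obtain ⟨v, hv⟩ := dp_ge x
    rw [stage_add_next_vec_eq hR.posSemidef.isSymm hP.isSymm hdet] at hv
    linarith [hG.posSemidef.quadratic_nonneg (v - riccatiGain A B R P *ᵥ x)]

/-- For a solvable LQR problem the largest solution of the Riccati equation is positive
semidefinite and its gain is stabilizing. -/
theorem IsLargestDARESolution.posSemidef_and_isSchurStable {A : Matrix (Fin n) (Fin n) ℝ}
    {B : Matrix (Fin n) (Fin m) ℝ} {Q : Matrix (Fin n) (Fin n) ℝ} {R : Matrix (Fin m) (Fin m) ℝ}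
    {P : Matrix (Fin n) (Fin n) ℝ} (hP : IsLargestDARESolution A B Q R P)
    (hQ : Q.PosSemidef) (hR : R.PosDef) (h : LQRSolvable A B Q R) :
    P.PosSemidef ∧ (A + B * riccatiGain A B R P).IsSchurStable := by
  obtain ⟨P₀, hP₀, hatt, hle⟩ := h.exists_value hQ hR.posSemidef
  have hge := hP.2 P₀ (isDARESolution_of_value hQ hR hP₀ hatt hle)
  have hPs : P.PosSemidef := by simpa using hge.add hP₀
  refine ⟨hPs, Matrix.isSchurStable_of_orbits fun x₀ => ?_⟩
  obtain ⟨u, hu, hsum⟩ := hatt x₀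
  set K := riccatiGain A B R P with hK
  set x := stateTrajectory A B x₀ u with hx
  have hG := posDef_inputWeight hR hPs B
  set G := R + Bᵀ * P * B
  have htel : ∀ N : ℕ, ∑ t ∈ Finset.range N, stageCost A B Q R x₀ u t + x N ⬝ᵥ (P *ᵥ x N) =
      x₀ ⬝ᵥ (P *ᵥ x₀) +
        ∑ t ∈ Finset.range N, (u t - K *ᵥ x t) ⬝ᵥ (G *ᵥ (u t - K *ᵥ x t)) := fun N => by
    induction N with
    | zero => simp [hx, stateTrajectory]
    | succ N ih =>
      have := stage_add_next_vec_eq (A := A) hR.posSemidef.isSymm hP.1.1 hP.1.2.1 Q (x N) (u N)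
      rw [← hP.1.2.2] at this
      have hnext : x (N + 1) = A *ᵥ x N + B *ᵥ u N := rfl
      rw [Finset.sum_range_succ, Finset.sum_range_succ, hnext]
      have hst : stageCost A B Q R x₀ u N = x N ⬝ᵥ (Q *ᵥ x N) + u N ⬝ᵥ (R *ᵥ u N) := rfl
      linarith
  -- The cost so far is at most the value `x₀ᵀ * P₀ * x₀`, itself at most `x₀ᵀ * P * x₀`. So each
  -- square is bounded by the terminal term of `htel`, which tends to zero.
  have hfeed : ∀ t, u t = K *ᵥ x t := fun t => by
    refine sub_eq_zero.1 (hG.eq_zero_of_quadratic_nonpos ?_)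
    have hc : Continuous fun y : Fin n → ℝ => y ⬝ᵥ (P *ᵥ y) := by fun_prop
    have hlim := (hc.tendsto 0).comp hu
    simp only [zero_dotProduct] at hlim
    refine ge_of_tendsto hlim (Filter.eventually_atTop.2 ⟨t + 1, fun N hN => ?_⟩)
    have h1 := htel N
    have h2 := sum_le_hasSum (Finset.range N) (fun s _ => stageCost_nonneg hQ hR.posSemidef A B x₀ u s) hsum
    have h3 := Finset.single_le_sum
      (f := fun t => (u t - K *ᵥ x t) ⬝ᵥ (G *ᵥ (u t - K *ᵥ x t)))
      (fun s _ => hG.posSemidef.quadratic_nonneg _) (Finset.mem_range.2 hN)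
    have h4 := hge.quadratic_nonneg x₀
    rw [Matrix.sub_mulVec, dotProduct_sub] at h4
    simp only [Function.comp_apply] at h3 ⊢
    linarith
  have horb : ∀ t : ℕ, (A + B * K) ^ t *ᵥ x₀ = x t := fun t => by
    induction t with
    | zero => simp [hx, stateTrajectory]
    | succ t ih =>
      rw [pow_succ', ← Matrix.mulVec_mulVec, ih, Matrix.add_mulVec, ← Matrix.mulVec_mulVec,
        ← hfeed]
      rfl
  simp_rw [horb]
  exact hu

end Riccati

/-! ### Consequences for all systems consistent with the data. -/

namespace InputStateData

variable {n m : ℕ} {D : InputStateData n m} {Q : Matrix (Fin n) (Fin n) ℝ}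
  {R : Matrix (Fin m) (Fin m) ℝ} {K : Matrix (Fin m) (Fin n) ℝ}

theorem Consistent.add {A A₀ : Matrix (Fin n) (Fin n) ℝ} {B B₀ : Matrix (Fin n) (Fin m) ℝ}
    (h : D.Consistent A B) (h₀ : A₀ * D.Xminus + B₀ * D.Uminus = 0) :
    D.Consistent (A + A₀) (B + B₀) := by
  rw [Consistent, Matrix.add_mul, Matrix.add_mul, add_add_add_comm, h₀, add_zero]
  exact h

theorem Consistent.sub {A A' : Matrix (Fin n) (Fin n) ℝ} {B B' : Matrix (Fin n) (Fin m) ℝ}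
    (h : D.Consistent A B) (h' : D.Consistent A' B') :
    (A - A') * D.Xminus + (B - B') * D.Uminus = 0 := by
  rw [Matrix.sub_mul, Matrix.sub_mul, ← sub_eq_zero.2 (h.symm.trans h')]
  abel

theorem IsCommonOptimalGain.exists_stable (hK : D.IsCommonOptimalGain Q R K) (hQ : Q.PosSemidef)
    (hR : R.PosDef) {A : Matrix (Fin n) (Fin n) ℝ} {B : Matrix (Fin n) (Fin m) ℝ}
    (h : D.Consistent A B) :
    (A + B * K).IsSchurStable ∧ ∃ P : Matrix (Fin n) (Fin n) ℝ, P.PosSemidef ∧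
      IsDARESolution A B Q R P ∧ K = riccatiGain A B R P := by
  obtain ⟨hsol, P, hP, rfl⟩ := hK A B h
  have := hP.posSemidef_and_isSchurStable hQ hR hsol
  exact ⟨this.2, P, this.1, hP.1, rfl⟩

/-- A common optimal gain satisfies every linear relation between the data. -/
theorem IsCommonOptimalGain.relation (hK : D.IsCommonOptimalGain Q R K) (hQ : Q.PosSemidef)
    (hR : R.PosDef) {A A₀ : Matrix (Fin n) (Fin n) ℝ} {B B₀ : Matrix (Fin n) (Fin m) ℝ}
    (h : D.Consistent A B) (h₀ : A₀ * D.Xminus + B₀ * D.Uminus = 0) : A₀ + B₀ * K = 0 := by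
  refine Matrix.eq_zero_of_forall_isSchurStable (M := A + B * K) fun F => ?_
  -- Row relations of the data are closed under left multiplication, so `F` is free.
  have hF : (F * A₀) * D.Xminus + (F * B₀) * D.Uminus = 0 := by
    rw [Matrix.mul_assoc, Matrix.mul_assoc, ← Matrix.mul_add, h₀, Matrix.mul_zero]
  have := (hK.exists_stable hQ hR (h.add hF)).1
  rwa [Matrix.add_mul, add_add_add_comm, Matrix.mul_assoc F, ← Matrix.mul_add] at this

theorem IsCommonOptimalGain.closedLoop_eq (hK : D.IsCommonOptimalGain Q R K) (hQ : Q.PosSemidef)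
    (hR : R.PosDef) {A A' : Matrix (Fin n) (Fin n) ℝ} {B B' : Matrix (Fin n) (Fin m) ℝ}
    (h : D.Consistent A B) (h' : D.Consistent A' B') : A + B * K = A' + B' * K := by
  have := hK.relation hQ hR h (h.sub h')
  rw [Matrix.sub_mul, sub_add_sub_comm] at this
  exact sub_eq_zero.1 this

/-- Each system brings its own Riccati solution, but all of them solve the Lyapunov equation of the
same stable closed loop, so they coincide. -/
theorem IsCommonOptimalGain.exists_isCommonRiccatiSolution (hK : D.IsCommonOptimalGain Q R K)
    (hQ : Q.PosSemidef) (hR : R.PosDef) {A : Matrix (Fin n) (Fin n) ℝ}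
    {B : Matrix (Fin n) (Fin m) ℝ} (h : D.Consistent A B) :
    ∃ M P, D.IsCommonRiccatiSolution Q R K M P := by
  obtain ⟨hst, P, hP, hric, hgain⟩ := hK.exists_stable hQ hR h
  refine ⟨A + B * K, P, hP, fun A' B' h' => ?_⟩
  obtain ⟨-, P', -, hric', hgain'⟩ := hK.exists_stable hQ hR h'
  have hM := hK.closedLoop_eq hQ hR h h'
  have hl := hric.lyapunov hR.posSemidef.isSymm hgain
  have hl' := hric'.lyapunov hR.posSemidef.isSymm hgain'
  rw [← hM] at hl'
  obtain rfl := hst.eq_of_lyapunov (hl.trans hl'.symm)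
  exact ⟨hM, hric', hl, hgain'⟩

/-- The matrix `ℒ(P)` of a solution of the Riccati equation is minus a square. -/
theorem calL_eq_neg_square {A : Matrix (Fin n) (Fin n) ℝ} {B : Matrix (Fin n) (Fin m) ℝ}
    {P : Matrix (Fin n) (Fin n) ℝ} (h : D.Consistent A B) (hP : IsDARESolution A B Q R P)
    (hR : R.IsSymm) (hK : K = riccatiGain A B R P) :
    D.calL Q R P =
      -((D.Uminus - K * D.Xminus)ᵀ * (R + Bᵀ * P * B) * (D.Uminus - K * D.Xminus)) := by
  have := hP.stage_add_next_eq hR D.Xminus D.Uminus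
  rw [← hK, ← sub_eq_iff_eq_add'] at this
  rw [← this, calL, show D.Xplus = _ from h]
  abel

/-- Compression by `S` replaces the data by the closed loop and turns the constraint `ℒ(P) ≤ 0` into
a Lyapunov inequality. -/
theorem transpose_mul_calL_mul {M : Matrix (Fin n) (Fin n) ℝ} {S : Matrix D.Col (Fin n) ℝ}
    (h1 : D.Xminus * S = 1) (hU : D.Uminus * S = K) (hX : D.Xplus * S = M)
    (P : Matrix (Fin n) (Fin n) ℝ) :
    Sᵀ * D.calL Q R P * S = P - Mᵀ * P * M - (Kᵀ * R * K + Q) := by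
  have key : ∀ {k : ℕ} (Z : Matrix (Fin k) D.Col ℝ) (W : Matrix (Fin k) (Fin k) ℝ),
      Sᵀ * (Zᵀ * W * Z) * S = (Z * S)ᵀ * W * (Z * S) := fun Z W => by
    simp only [Matrix.transpose_mul, Matrix.mul_assoc]
  simp only [calL, Matrix.mul_sub, Matrix.sub_mul, key, h1, hU, hX, Matrix.transpose_one,
    Matrix.one_mul, Matrix.mul_one]
  abel

end InputStateData

/-! ### The semidefinite program and the recovery of the gain. -/

theorem mainTheorem6 {n m : ℕ} (D : InputStateData n m)
    (Q : Matrix (Fin n) (Fin n) ℝ) (R : Matrix (Fin m) (Fin m) ℝ)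
    (hQ : Q.PosSemidef) (hR : R.PosDef)
    (As : Matrix (Fin n) (Fin n) ℝ) (Bs : Matrix (Fin n) (Fin m) ℝ) (hs : D.Consistent As Bs)
    (hinf : D.InformativeForLQR Q R)
    (K : Matrix (Fin m) (Fin n) ℝ) (hK : D.IsCommonOptimalGain Q R K) :
    (∃ M P, D.IsCommonRiccatiSolution Q R K M P) ∧
      ∀ M P, D.IsCommonRiccatiSolution Q R K M P →
        D.sdpSolutions Q R = {P} ∧
        (∃ Xsharp : Matrix D.Col (Fin n) ℝ, D.Xminus * Xsharp = 1 ∧ D.calL Q R P * Xsharp = 0) ∧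
        ∀ Xsharp : Matrix D.Col (Fin n) ℝ,
          D.Xminus * Xsharp = 1 → D.calL Q R P * Xsharp = 0 → K = D.Uminus * Xsharp := by
  refine ⟨hK.exists_isCommonRiccatiSolution hQ hR hs, fun M P hMP => ?_⟩
  obtain ⟨hP, hcommon⟩ := hMP
  obtain ⟨hM, hric, hlyap, hgain⟩ := hcommon As Bs hs
  have hst : M.IsSchurStable := hM ▸ (hK.exists_stable hQ hR hs).1
  have hG := posDef_inputWeight hR hP Bs
  have hL := D.calL_eq_neg_square hs hric hR.posSemidef.isSymm hgain
  set E := D.Uminus - K * D.Xminus with hE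
  have hES : ∀ S : Matrix D.Col (Fin n) ℝ, D.Xminus * S = 1 → E * S = D.Uminus * S - K :=
    fun S h1 => by rw [hE, Matrix.sub_mul, Matrix.mul_assoc, h1, Matrix.mul_one]
  obtain ⟨S, hS1, hSU⟩ := Matrix.exists_common_right_factor (X := D.Xminus) (U := D.Uminus) (K := K)
    fun A₀ B₀ h₀ => hK.relation hQ hR hs h₀
  have hSX : D.Xplus * S = M := by
    rw [show D.Xplus = _ from hs, Matrix.add_mul, Matrix.mul_assoc, Matrix.mul_assoc, hS1, hSU,
      Matrix.mul_one, hM]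
  have hfeas : P ∈ D.sdpFeasible Q R :=
    ⟨hP, by rw [hL, neg_neg]; exact hG.posSemidef.transpose_mul_mul_same E⟩
  -- Stronger than trace maximality: `P` dominates every feasible point in the semidefinite order.
  -- Uniqueness follows since a semidefinite matrix of trace zero is zero.
  have hmax : ∀ P' ∈ D.sdpFeasible Q R, (P - P').PosSemidef := by
    intro P' hP'
    refine hst.posSemidef_of_lyapunov (hP.isSymm.sub hP'.1.isSymm) ?_
    have h1 := hP'.2.transpose_mul_mul_same S
    rw [Matrix.mul_neg, Matrix.neg_mul, D.transpose_mul_calL_mul hS1 hSU hSX, ← hlyap] at h1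
    convert! h1 using 1
    rw [Matrix.mul_sub, Matrix.sub_mul]
    abel
  refine ⟨?_, ⟨S, hS1, ?_⟩, fun S' h1 h2 => ?_⟩
  · ext P'
    refine ⟨fun h => ?_, ?_⟩
    · have hd := hmax P' h.1
      have ht := h.2 P hfeas
      have h0 : (P - P').trace = 0 :=
        le_antisymm (by rw [Matrix.trace_sub]; linarith) hd.trace_nonneg
      exact (sub_eq_zero.1 (hd.trace_eq_zero_iff.1 h0)).symm
    · rintro rfl
      refine ⟨hfeas, fun P' hP' => ?_⟩
      have := (hmax P' hP').trace_nonneg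
      rw [Matrix.trace_sub] at this
      linarith
  · rw [hL, Matrix.neg_mul, Matrix.mul_assoc, hES S hS1, hSU, sub_self, Matrix.mul_zero, neg_zero]
  -- Multiplying `ℒ(P) * S' = 0` on the left by `S'ᵀ` leaves a square with positive definite weight.
  · have h3 : (E * S')ᵀ * (R + Bsᵀ * P * Bs) * (E * S') = 0 := by
      have := congrArg (S'ᵀ * ·) h2
      simp only [hL, Matrix.neg_mul, Matrix.mul_neg, Matrix.mul_zero, neg_eq_zero] at this
      simpa only [Matrix.transpose_mul, Matrix.mul_assoc] using this
    have h4 := hG.eq_zero_of_transpose_mul_mul_eq_zero h3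
    rw [hES S' h1] at h4
    exact (sub_eq_zero.1 h4).symm
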